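/- Let $\mathbb K=\mathbb R$ or $\mathbb C$ and $n\ge 0$. A $k$-current on $\mathbb R^n$ is a differential $k$-form $u=\sum_{|I|=k}u_I\,dx^I$ whose coefficients $u_I$ are $\mathbb K$-valued distributions on $\mathbb R^n$, with exterior derivative $du=\sum_{i=1}^n dx_i\wedge\partial_{x_i}u$. For $k\ge 0$ let $C^k$ be the $\mathbb K$-vector space of $k$-currents on $\mathbb R^n$ whose support is contained in $\{0\}$. Then the complex $$0\longrightarrow C^0\xrightarrow{\ d\ }C^1\xrightarrow{\ d\ }\cdots\xrightarrow{\ d\ }C^n\longrightarrow 0$$ has one-dimensional homology, concentrated in degree $n$: its homology in degree $k$ vanishes for every $k\ne n$, and its homology in degree $n$ is one-dimensional over $\mathbb K$ and is spanned by the class of the (closed) current $\delta(x)\,dx_1\wedge\cdots\wedge dx_n$, where $\delta$ is the Dirac distribution at the origin. -/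

import Mathlib

open Distribution TopologicalSpace CategoryTheory
open scoped Distributions LineDeriv ContDiff

noncomputable section

namespace OriginCurrents

/-! ### Distributions with support at the origin -/

section Support

variable {E : Type*} [NormedAddCommGroup E] [NormedSpace ℝ E] [FiniteDimensional ℝ E]
  {F : Type*} [AddCommGroup F] [Module ℝ F] [TopologicalSpace F]

/-- A test function multiplied by a smooth function. -/
def mulTest (g : E → ℝ) (hg : ContDiff ℝ ∞ g) (u : 𝓓((⊤ : Opens E), ℝ)) :
    𝓓((⊤ : Opens E), ℝ) :=
  ⟨fun x => g x * u x, hg.mul u.contDiff, u.hasCompactSupport.mul_left, fun _ _ => trivial⟩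

/-- A distribution vanishes on the complement of its support. -/
theorem isVanishingOn_compl_of_dsupport_subset {T : 𝓓'((⊤ : Opens E), F)} {s : Set E}
    (h : dsupport T ⊆ s) : IsVanishingOn T sᶜ := by
  intro u hu
  have hK : IsCompact (tsupport u) := u.hasCompactSupport
  have hx : ∀ x : tsupport u, ∃ U : Set E, IsVanishingOn T U ∧ IsOpen U ∧ (x : E) ∈ U := by
    intro x
    have : (x : E) ∉ dsupport T := fun hx => hu x.2 (h hx)
    simpa using this
  choose U hU1 hU2 hU3 using hx
  obtain ⟨t, ht⟩ := hK.elim_finite_subcover U hU2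
    (fun x hx => Set.mem_iUnion.2 ⟨⟨x, hx⟩, hU3 _⟩)
  obtain ⟨f, hf⟩ := SmoothPartitionOfUnity.exists_isSubordinate (modelWithCornersSelf ℝ E)
    (isClosed_tsupport u) (fun i : t => U i) (fun i => hU2 i)
    (by intro x hx; simpa using ht hx)
  have hsum : u = ∑ i : t, mulTest (f i) (f i).contMDiff.contDiff u := by
    ext x
    have e : (∑ i : t, mulTest (f i) (f i).contMDiff.contDiff u) x
        = ∑ i : t, f i x * u x := by
      have := map_sum (⟨⟨fun v : 𝓓((⊤ : Opens E), ℝ) => v x, rfl⟩, fun _ _ => rfl⟩ :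
        𝓓((⊤ : Opens E), ℝ) →+ ℝ)
        (fun i : t => mulTest (f i) (f i).contMDiff.contDiff u) Finset.univ
      exact this
    rw [e, ← Finset.sum_mul]
    by_cases hxu : x ∈ tsupport u
    · have := f.sum_eq_one hxu
      rw [finsum_eq_sum_of_fintype] at this
      rw [this, one_mul]
    · rw [image_eq_zero_of_notMem_tsupport hxu, mul_zero]
  rw [hsum, map_sum]
  refine Finset.sum_eq_zero fun i _ => hU1 i _ ?_
  exact (tsupport_mul_subset_left (f := f i) (g := u)).trans (hf i)

theorem dsupport_subset_zero_iff {T : 𝓓'((⊤ : Opens E), F)} :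
    dsupport T ⊆ {0} ↔ IsVanishingOn T ({0}ᶜ : Set E) :=
  ⟨isVanishingOn_compl_of_dsupport_subset, fun h =>
    Set.sInter_subset_of_mem ⟨h, isClosed_singleton⟩⟩

end Support

/-! ### Currents on `ℝⁿ` -/

/-- `ℝⁿ`. -/
abbrev Space (n : ℕ) : Type := EuclideanSpace ℝ (Fin n)

/-- The constant `k`-forms on `ℝⁿ` with values in `𝕜`. -/
abbrev ConstForm (𝕜 : Type*) [RCLike 𝕜] (n k : ℕ) : Type _ := Space n [⋀^Fin k]→L[ℝ] 𝕜

/-- The `k`-currents on `ℝⁿ`, that is, the `k`-forms with distributional coefficients. -/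
abbrev Current (𝕜 : Type*) [RCLike 𝕜] (n k : ℕ) : Type _ :=
  𝓓'((⊤ : Opens (Space n)), ConstForm 𝕜 n k)

variable {𝕜 : Type*} [RCLike 𝕜] {n k : ℕ}

/-- The `i`-th standard unit vector. -/
def unitVec (i : Fin n) : Space n := EuclideanSpace.single i 1

/-- The operation `η ↦ dxᵢ ∧ η` on constant forms. -/
def dxWedge (i : Fin n) : ConstForm 𝕜 n k →L[ℝ] ConstForm 𝕜 n (k + 1) :=
  (ContinuousAlternatingMap.alternatizeUncurryFinCLM ℝ (Space n) 𝕜).comp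
    (ContinuousLinearMap.smulRightL ℝ (Space n) (ConstForm 𝕜 n k)
      (EuclideanSpace.proj i : Space n →L[ℝ] ℝ))

theorem dxWedge_apply (i : Fin n) (η : ConstForm 𝕜 n k) (v : Fin (k + 1) → Space n) :
    dxWedge i η v = ∑ j : Fin (k + 1), (-1) ^ (j : ℕ) • ((v j i : ℝ) • η (j.removeNth v)) := by
  simp [dxWedge, ContinuousAlternatingMap.alternatizeUncurryFin_apply]

theorem dxWedge_smul (i : Fin n) (c : 𝕜) (η : ConstForm 𝕜 n k) :
    dxWedge i (c • η) = c • dxWedge i η := by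
  ext v
  simp only [dxWedge_apply, ContinuousAlternatingMap.smul_apply, Finset.smul_sum]
  exact Finset.sum_congr rfl fun j _ => by
    rw [smul_comm _ c, smul_comm _ c]

/-- The exterior derivative `d T = ∑ᵢ dxᵢ ∧ ∂ᵢ T` of a current. -/
def currentD (𝕜 : Type*) [RCLike 𝕜] (n k : ℕ) : Current 𝕜 n k →ₗ[𝕜] Current 𝕜 n (k + 1) where
  toFun T := ∑ i : Fin n, Distribution.mapCLM (dxWedge i) (∂_{unitVec i} T)
  map_add' S T := by
    simp only [LineDeriv.lineDerivOp_add, map_add, Finset.sum_add_distrib]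
  map_smul' c T := by
    rw [RingHom.id_apply, Finset.smul_sum]
    refine Finset.sum_congr rfl fun i _ => ?_
    ext1 φ
    have h : (∂_{unitVec i} (c • T)) φ = c • (∂_{unitVec i} T) φ := by
      rw [Distribution.lineDerivOp_apply_apply, Distribution.lineDerivOp_apply_apply]
      rfl
    change dxWedge i ((∂_{unitVec i} (c • T)) φ) = c • dxWedge i ((∂_{unitVec i} T) φ)
    rw [h, dxWedge_smul]

theorem currentD_apply (T : Current 𝕜 n k) (φ : 𝓓((⊤ : Opens (Space n)), ℝ)) :
    currentD 𝕜 n k T φ = ∑ i : Fin n, dxWedge i ((∂_{unitVec i} T) φ) := by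
  have := map_sum (⟨⟨fun S : Current 𝕜 n (k + 1) => S φ, rfl⟩, fun _ _ => rfl⟩ :
    Current 𝕜 n (k + 1) →+ ConstForm 𝕜 n (k + 1))
    (fun i : Fin n => Distribution.mapCLM (dxWedge i) (∂_{unitVec i} T)) Finset.univ
  exact this

theorem lineDeriv_test_comm (φ : 𝓓((⊤ : Opens (Space n)), ℝ)) (v w : Space n) :
    (∂_{v} (∂_{w} φ) : 𝓓((⊤ : Opens (Space n)), ℝ)) = ∂_{w} (∂_{v} φ) := by
  have key : ∀ (u : 𝓓((⊤ : Opens (Space n)), ℝ)) (a : Space n),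
      ((∂_{a} u : 𝓓((⊤ : Opens (Space n)), ℝ)) : Space n → ℝ) = fun x => fderiv ℝ u x a := by
    intro u a
    ext x
    have := TestFunction.lineDerivCLM_apply_of_le (𝕜 := ℝ) (f := u) (v := a) (x := x)
      (k := (⊤ : ℕ∞)) (n := (⊤ : ℕ∞)) le_top
    rw [((u.contDiff.differentiable (by simp)).differentiableAt).lineDeriv_eq_fderiv] at this
    exact this
  ext x
  have h2 : ∀ a b : Space n, fderiv ℝ (fun y => fderiv ℝ φ y a) x b
      = fderiv ℝ (fderiv ℝ φ) x b a := by
    intro a b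
    have hd : DifferentiableAt ℝ (fderiv ℝ φ) x :=
      ((φ.contDiff.fderiv_right (m := 1) (by norm_cast)).differentiable
        one_ne_zero).differentiableAt
    rw [fderiv_clm_apply hd (differentiableAt_const a)]
    simp
  simp only [key]
  rw [h2, h2]
  have hs : IsSymmSndFDerivAt ℝ φ x :=
    (φ.contDiff.contDiffAt (x := x)).isSymmSndFDerivAt (by simp; norm_cast)
  exact hs v w

theorem lineDeriv_comm (T : Current 𝕜 n k) (v w : Space n) :
    (∂_{v} (∂_{w} T) : Current 𝕜 n k) = ∂_{w} (∂_{v} T) := by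
  ext1 φ
  simp only [Distribution.lineDerivOp_apply_apply, map_neg]
  rw [lineDeriv_test_comm]

theorem alternatize_anticomm {E F : Type*} [NormedAddCommGroup E] [NormedSpace ℝ E]
    [NormedAddCommGroup F] [NormedSpace ℝ F] (p q : E →L[ℝ] ℝ) (η : E [⋀^Fin k]→L[ℝ] F) :
    ContinuousAlternatingMap.alternatizeUncurryFin
      (p.smulRight (ContinuousAlternatingMap.alternatizeUncurryFin (q.smulRight η))) =
    - ContinuousAlternatingMap.alternatizeUncurryFin
      (q.smulRight (ContinuousAlternatingMap.alternatizeUncurryFin (p.smulRight η))) := by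
  have h (a b : E →L[ℝ] ℝ) :
      a.smulRight (ContinuousAlternatingMap.alternatizeUncurryFin (b.smulRight η)) =
      (ContinuousAlternatingMap.alternatizeUncurryFinCLM ℝ E F).comp
        (a.smulRight (b.smulRight η)) := by
    ext1 x
    simp
  have h0 := ContinuousAlternatingMap.alternatizeUncurryFin_alternatizeUncurryFinCLM_comp_of_symmetric
    (f := p.smulRight (q.smulRight η) + q.smulRight (p.smulRight η)) (by
      intro x y
      ext v
      simp
      module)
  rw [ContinuousLinearMap.comp_add, ContinuousAlternatingMap.alternatizeUncurryFin_add,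
    ← h, ← h] at h0
  exact eq_neg_of_add_eq_zero_left h0

theorem dxWedge_anticomm (i j : Fin n) (η : ConstForm 𝕜 n k) :
    dxWedge i (dxWedge j η) = - dxWedge j (dxWedge i η) :=
  alternatize_anticomm (EuclideanSpace.proj i) (EuclideanSpace.proj j) η

theorem currentD_currentD (T : Current 𝕜 n k) :
    currentD 𝕜 n (k + 1) (currentD 𝕜 n k T) = 0 := by
  have h : ∀ φ, currentD 𝕜 n (k + 1) (currentD 𝕜 n k T) φ = ∑ i : Fin n, ∑ j : Fin n,
      dxWedge i (dxWedge j ((∂_{unitVec i} (∂_{unitVec j} T)) φ)) := by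
    intro φ
    rw [currentD_apply]
    refine Finset.sum_congr rfl fun i _ => ?_
    rw [Distribution.lineDerivOp_apply_apply, currentD_apply, map_sum]
    refine Finset.sum_congr rfl fun j _ => ?_
    rw [Distribution.lineDerivOp_apply_apply (∂_{unitVec j} T)]
  ext1 φ
  have h1 : currentD 𝕜 n (k + 1) (currentD 𝕜 n k T) φ =
      - currentD 𝕜 n (k + 1) (currentD 𝕜 n k T) φ := by
    conv_rhs => rw [h, Finset.sum_comm]
    rw [h, ← Finset.sum_neg_distrib]
    refine Finset.sum_congr rfl fun i _ => ?_
    rw [← Finset.sum_neg_distrib]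
    refine Finset.sum_congr rfl fun j _ => ?_
    rw [dxWedge_anticomm, lineDeriv_comm]
  have h2 : ∀ a : 𝕜, a = -a → a = 0 := fun a ha => self_eq_neg.1 ha
  ext v
  exact h2 _ (congrArg (fun η : ConstForm 𝕜 n (k + 1 + 1) => η v) h1)

/-! ### The complex of currents supported at the origin -/

/-- The `k`-currents on `ℝⁿ` with support contained in `{0}`. -/
def originCurrents (𝕜 : Type*) [RCLike 𝕜] (n k : ℕ) : Submodule 𝕜 (Current 𝕜 n k) where
  carrier := {T | dsupport T ⊆ {0}}
  zero_mem' := dsupport_subset_zero_iff.2 fun _ _ => rfl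
  add_mem' {S T} hS hT := dsupport_subset_zero_iff.2 fun u hu => by
    have h1 := dsupport_subset_zero_iff.1 hS u hu
    have h2 := dsupport_subset_zero_iff.1 hT u hu
    change S u + T u = 0
    rw [h1, h2, add_zero]
  smul_mem' c T hT := dsupport_subset_zero_iff.2 fun u hu => by
    have h := dsupport_subset_zero_iff.1 hT u hu
    change c • T u = 0
    rw [h, smul_zero]

theorem currentD_mem {T : Current 𝕜 n k} (hT : T ∈ originCurrents 𝕜 n k) :
    currentD 𝕜 n k T ∈ originCurrents 𝕜 n (k + 1) := by
  refine dsupport_subset_zero_iff.2 fun u hu => ?_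
  rw [currentD_apply]
  refine Finset.sum_eq_zero fun i _ => ?_
  have h : (∂_{unitVec i} T) u = 0 :=
    IsVanishingOn.lineDerivOp (dsupport_subset_zero_iff.1 hT) (unitVec i) u hu
  rw [h, map_zero]

/-- The exterior derivative on currents supported at the origin. -/
def originD (𝕜 : Type*) [RCLike 𝕜] (n k : ℕ) :
    originCurrents 𝕜 n k →ₗ[𝕜] originCurrents 𝕜 n (k + 1) :=
  (currentD 𝕜 n k).restrict fun _ hT => currentD_mem hT

/-- The complex `0 → C⁰ → C¹ → ⋯` of currents on `ℝⁿ` supported at the origin, with the exterior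
derivative as differential. -/
def originComplex (𝕜 : Type*) [RCLike 𝕜] (n : ℕ) : CochainComplex (ModuleCat 𝕜) ℕ :=
  CochainComplex.of (fun k => ModuleCat.of 𝕜 (originCurrents 𝕜 n k))
    (fun k => ModuleCat.ofHom (originD 𝕜 n k))
    (fun k => by
      rw [← ModuleCat.ofHom_comp, ← ModuleCat.ofHom_zero]
      congr 1
      exact LinearMap.ext fun T => Subtype.ext (currentD_currentD (T : Current 𝕜 n k)))

/-! ### The current `δ(x) dx₁ ∧ ⋯ ∧ dxₙ` -/

/-- The constant form `dx₁ ∧ ⋯ ∧ dxₙ`, whose value at `(v₁, …, vₙ)` is the determinant of the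
matrix whose rows are `v₁, …, vₙ`. -/
def volForm (𝕜 : Type*) [RCLike 𝕜] (n : ℕ) : ConstForm 𝕜 n n where
  toAlternatingMap := (Algebra.linearMap ℝ 𝕜).compAlternatingMap
    (Matrix.detRowAlternating.compLinearMap
      (EuclideanSpace.equiv (Fin n) ℝ).toLinearEquiv.toLinearMap)
  cont := by
    have : Continuous fun v : Fin n → Space n =>
        algebraMap ℝ 𝕜 (Matrix.det (Matrix.of fun i j => v i j)) :=
      (RCLike.continuous_ofReal).comp (Continuous.matrix_det (by fun_prop))
    exact this

theorem volForm_apply (𝕜 : Type*) [RCLike 𝕜] (n : ℕ) (v : Fin n → Space n) :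
    volForm 𝕜 n v = algebraMap ℝ 𝕜 (Matrix.det (Matrix.of fun i j => v i j)) := rfl

/-- The `n`-current `δ(x) dx₁ ∧ ⋯ ∧ dxₙ`, sending a test function `φ` to `φ(0) dx₁ ∧ ⋯ ∧ dxₙ`. -/
def deltaVol (𝕜 : Type*) [RCLike 𝕜] (n : ℕ) : Current 𝕜 n n :=
  Distribution.mapCLM (ContinuousLinearMap.toSpanSingleton ℝ (volForm 𝕜 n))
    (Distribution.delta (0 : Space n))

theorem deltaVol_mem (𝕜 : Type*) [RCLike 𝕜] (n : ℕ) : deltaVol 𝕜 n ∈ originCurrents 𝕜 n n := by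
  refine dsupport_subset_zero_iff.2 fun u hu => ?_
  have h : (Distribution.delta (0 : Space n) : 𝓓'((⊤ : Opens (Space n)), ℝ)) u = 0 :=
    isVanishingOn_delta 0 u hu
  rw [deltaVol, Distribution.mapCLM_apply, h, map_zero]

/-- The current `δ(x) dx₁ ∧ ⋯ ∧ dxₙ` as a degree `n` element of the complex. -/
def deltaCochain (𝕜 : Type*) [RCLike 𝕜] (n : ℕ) : (originComplex 𝕜 n).X n :=
  (⟨deltaVol 𝕜 n, deltaVol_mem 𝕜 n⟩ : originCurrents 𝕜 n n)

end OriginCurrents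
end

/-! Let `E = ∑ xᵢ ∂ᵢ`. Cartan's formula `L = dι + ιd` for the Lie derivative along `E` makes `L`
zero on homology (`eulerLie_mem_boundaries`). On `k`-currents, `L + (n - k) + m` is the transpose of
the operator `m - E` on test functions (`transpose_eulerShift`).

A distribution supported at `0` depends only on a finite jet at `0` (`exists_forall_flat_eq_zero`),
and `E` multiplies the `j`-th derivative at `0` by `j`. Hence the product of the `m - E` for `m = 0,
…, N` kills all `N`-jets, and the product of the `L + (n - k) + m` kills `T`. If `T` is closed, each
factor acts on its class as the scalar `n - k + m`, which is nonzero for `k < n`, so `T` is exact.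

For `k = n` only the factor `m = 0` is singular. Omitting it leaves the value at `0` as sole
obstruction: `T` is exact as soon as `T (bump n) = 0`. This value lies in the line spanned by
`volForm`, vanishes on boundaries, and is nonzero for `deltaVol`. For `k > n` there are no nonzero
forms. -/

noncomputable section

namespace OriginCurrents

/-! ### Operators on test functions and the Euler operator -/

section Operators

variable {E : Type*} [NormedAddCommGroup E] [NormedSpace ℝ E]

/-- Multiplication of test functions by a fixed smooth function, as a continuous linear map. -/
def mulTestCLM (g : E → ℝ) (hg : ContDiff ℝ ∞ g) :
    𝓓((⊤ : Opens E), ℝ) →L[ℝ] 𝓓((⊤ : Opens E), ℝ) :=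
  TestFunction.limitCLM ℝ (mulTest g hg)
    (fun K hK => (TestFunction.ofSupportedInCLM ℝ hK).comp
      (ContDiffMapSupportedIn.bilinLeftCLM (ContinuousLinearMap.mul ℝ ℝ) hg))
    (fun K hK f => by
      ext x
      exact mul_comm _ _)

theorem lineDeriv_test_apply (φ : 𝓓((⊤ : Opens E), ℝ)) (v x : E) :
    (∂_{v} φ : 𝓓((⊤ : Opens E), ℝ)) x = fderiv ℝ φ x v := by
  have := TestFunction.lineDerivCLM_apply_of_le (𝕜 := ℝ) (f := φ) (v := v) (x := x)
    (k := (⊤ : ℕ∞)) (n := (⊤ : ℕ∞)) le_top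
  rwa [((φ.contDiff.differentiable (by simp)).differentiableAt).lineDeriv_eq_fderiv] at this

/-- The transpose of a continuous operator on test functions. -/
def transpose {F : Type*} [AddCommGroup F] [Module ℝ F] [TopologicalSpace F]
    [IsTopologicalAddGroup F] [ContinuousSMul ℝ F]
    (A : 𝓓((⊤ : Opens E), ℝ) →L[ℝ] 𝓓((⊤ : Opens E), ℝ)) (T : 𝓓'((⊤ : Opens E), F)) :
    𝓓'((⊤ : Opens E), F) :=
  A.precompCompactConvergenceCLM F T

end Operators

variable {𝕜 : Type*} [RCLike 𝕜] {n k : ℕ}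

/-- Multiplication of test functions by the `i`-th coordinate. -/
def coordMul (i : Fin n) :
    𝓓((⊤ : Opens (Space n)), ℝ) →L[ℝ] 𝓓((⊤ : Opens (Space n)), ℝ) :=
  mulTestCLM (fun x : Space n => x i) (EuclideanSpace.proj i : Space n →L[ℝ] ℝ).contDiff

@[simp]
theorem coordMul_apply (i : Fin n) (φ : 𝓓((⊤ : Opens (Space n)), ℝ)) (x : Space n) :
    coordMul i φ x = x i * φ x := rfl

theorem sum_test_apply {ι : Type*} (s : Finset ι) (f : ι → 𝓓((⊤ : Opens (Space n)), ℝ))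
    (x : Space n) : (∑ i ∈ s, f i) x = ∑ i ∈ s, f i x :=
  map_sum (⟨⟨fun v : 𝓓((⊤ : Opens (Space n)), ℝ) => v x, rfl⟩, fun _ _ => rfl⟩ :
    𝓓((⊤ : Opens (Space n)), ℝ) →+ ℝ) f s

theorem sum_current_apply {ι : Type*} (s : Finset ι) (f : ι → Current 𝕜 n k)
    (φ : 𝓓((⊤ : Opens (Space n)), ℝ)) : (∑ i ∈ s, f i) φ = ∑ i ∈ s, f i φ :=
  map_sum (⟨⟨fun S : Current 𝕜 n k => S φ, rfl⟩, fun _ _ => rfl⟩ :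
    Current 𝕜 n k →+ ConstForm 𝕜 n k) f s

/-- The Euler operator `∑ᵢ xᵢ ∂ᵢ` on test functions. -/
def euler (n : ℕ) : 𝓓((⊤ : Opens (Space n)), ℝ) →L[ℝ] 𝓓((⊤ : Opens (Space n)), ℝ) :=
  ∑ i : Fin n, (coordMul i).comp (TestFunction.lineDerivCLM ℝ (unitVec i))

theorem euler_eq_sum (φ : 𝓓((⊤ : Opens (Space n)), ℝ)) :
    euler n φ = ∑ i : Fin n, coordMul i (∂_{unitVec i} φ) := by
  simp only [euler, sum_apply, ContinuousLinearMap.comp_apply]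
  rfl

theorem sum_smul_unitVec (x : Space n) : ∑ i : Fin n, x i • unitVec i = x := by
  ext j
  simp [unitVec, Pi.single_apply]

theorem euler_apply (φ : 𝓓((⊤ : Opens (Space n)), ℝ)) (x : Space n) :
    euler n φ x = fderiv ℝ φ x x := by
  rw [euler_eq_sum, sum_test_apply]
  conv_rhs => enter [2]; rw [← sum_smul_unitVec x]
  rw [map_sum]
  refine Finset.sum_congr rfl fun i _ => ?_
  rw [coordMul_apply, lineDeriv_test_apply, map_smul, smul_eq_mul]

theorem lineDeriv_coordMul (i j : Fin n) (φ : 𝓓((⊤ : Opens (Space n)), ℝ)) :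
    (∂_{unitVec j} (coordMul i φ) : 𝓓((⊤ : Opens (Space n)), ℝ)) =
      (if i = j then φ else 0) + coordMul i (∂_{unitVec j} φ) := by
  ext x
  have h1 : HasFDerivAt (fun y : Space n => y i) (EuclideanSpace.proj i : Space n →L[ℝ] ℝ) x :=
    (EuclideanSpace.proj i : Space n →L[ℝ] ℝ).hasFDerivAt
  have h2 : HasFDerivAt φ (fderiv ℝ φ x) x :=
    (φ.contDiff.differentiable (by simp)).differentiableAt.hasFDerivAt
  have h3 : fderiv ℝ (coordMul i φ) x = _ := (h1.mul h2).fderiv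
  rw [lineDeriv_test_apply, h3]
  change _ = (if i = j then φ else 0 : 𝓓((⊤ : Opens (Space n)), ℝ)) x + _
  rw [coordMul_apply, lineDeriv_test_apply]
  by_cases h : i = j
  · subst h
    simp [unitVec]
    ring
  · simp [unitVec, h]

/-! ### Contraction and Cartan's formula -/

/-- Contraction of constant forms with the `i`-th standard unit vector. -/
def contract (i : Fin n) : ConstForm 𝕜 n (k + 1) →L[ℝ] ConstForm 𝕜 n k :=
  (ContinuousLinearMap.apply ℝ (ConstForm 𝕜 n k) (unitVec i)).comp
    (ContinuousAlternatingMap.curryLeftLI (𝕜 := ℝ) (E := Space n) (F := 𝕜)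
      (n := k)).toContinuousLinearMap

theorem contract_apply (i : Fin n) (η : ConstForm 𝕜 n (k + 1)) (v : Fin k → Space n) :
    contract i η v = η (Matrix.vecCons (unitVec i) v) := rfl

theorem contract_dxWedge_zero (i j : Fin n) (η : ConstForm 𝕜 n 0) :
    contract i (dxWedge j η) = if i = j then η else 0 := by
  ext v
  rw [contract_apply, dxWedge_apply]
  by_cases h : i = j
  · subst h
    simp [unitVec]
  · simp [unitVec, h, Ne.symm h]

/-- In the expansion of `dxWedge`, slot `0` holds the inserted unit vector and yields the Kronecker
delta; the other slots cancel against the second summand. -/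
theorem contract_dxWedge_add (i j : Fin n) (η : ConstForm 𝕜 n (k + 1)) :
    contract i (dxWedge j η) + dxWedge j (contract i η) = if i = j then η else 0 := by
  ext v
  have h1 : (contract i (dxWedge j η) + dxWedge j (contract i η)) v =
      contract i (dxWedge j η) v + dxWedge j (contract i η) v := rfl
  rw [h1, contract_apply, dxWedge_apply, dxWedge_apply, Fin.sum_univ_succ]
  have h2 : ∀ l : Fin (k + 1), l.succ.removeNth (Matrix.vecCons (unitVec i) v)
      = Matrix.vecCons (unitVec i) (l.removeNth v) := by
    intro l
    funext m
    refine Fin.cases ?_ (fun m => ?_) m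
    · simp [Fin.removeNth_apply]
    · simp [Fin.removeNth_apply]
  have h3 : (0 : Fin (k + 1 + 1)).removeNth (Matrix.vecCons (unitVec i) v) = v := by
    funext m
    simp [Fin.removeNth_apply]
  simp only [h2, h3, contract_apply, Matrix.cons_val_succ, Fin.val_succ, pow_succ, mul_neg,
    mul_one, neg_smul, Finset.sum_neg_distrib, Matrix.cons_val_zero]
  rw [neg_add_cancel_right]
  by_cases h : i = j
  · subst h
    simp [unitVec]
  · simp [unitVec, h, Ne.symm h]

/-- Each of the `k + 1` slots contributes `η v`: expand `v j` in the standard basis and move it back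
to position `j`, which absorbs the sign. -/
theorem sum_dxWedge_contract (η : ConstForm 𝕜 n (k + 1)) :
    ∑ i : Fin n, dxWedge i (contract i η) = ((k : ℝ) + 1) • η := by
  ext v
  have h1 : (∑ i : Fin n, dxWedge i (contract i η)) v = ∑ i : Fin n, dxWedge i (contract i η) v := by
    simp
  have h2 : ∀ j : Fin (k + 1), ∑ i : Fin n, (-1 : ℤ) ^ (j : ℕ) • ((v j i : ℝ) •
      η (Matrix.vecCons (unitVec i) (j.removeNth v))) = η v := by
    intro j
    have h3 : ∀ x : Space n, η (Matrix.vecCons x (j.removeNth v)) =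
        η.curryLeft x (j.removeNth v) := fun _ => rfl
    rw [← Finset.smul_sum]
    have h4 : ∑ i : Fin n, (v j i : ℝ) • η (Matrix.vecCons (unitVec i) (j.removeNth v)) =
        η (Matrix.vecCons (v j) (j.removeNth v)) := by
      conv_rhs => rw [h3, ← sum_smul_unitVec (v j), map_sum]
      simp
    rw [h4, ← η.neg_one_pow_smul_map_insertNth j, smul_smul, ← mul_pow]
    simp
  rw [h1]
  simp only [dxWedge_apply, contract_apply]
  rw [Finset.sum_comm]
  simp only [h2]
  simp only [Finset.sum_const, Finset.card_univ, Fintype.card_fin, ← Nat.cast_smul_eq_nsmul ℝ]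
  push_cast
  rfl

/-- Contraction of a current with the Euler vector field. -/
def eulerContract (T : Current 𝕜 n (k + 1)) : Current 𝕜 n k :=
  ∑ i : Fin n, Distribution.mapCLM (contract i) (transpose (coordMul i) T)

theorem eulerContract_apply (T : Current 𝕜 n (k + 1)) (φ : 𝓓((⊤ : Opens (Space n)), ℝ)) :
    eulerContract T φ = ∑ i : Fin n, contract i (T (coordMul i φ)) := by
  rw [eulerContract, sum_current_apply]
  rfl

theorem eulerContract_mem {T : Current 𝕜 n (k + 1)} (hT : T ∈ originCurrents 𝕜 n (k + 1)) :
    eulerContract T ∈ originCurrents 𝕜 n k := by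
  refine dsupport_subset_zero_iff.2 fun u hu => ?_
  rw [eulerContract_apply]
  refine Finset.sum_eq_zero fun i _ => ?_
  have : T (coordMul i u) = 0 := dsupport_subset_zero_iff.1 hT _
    ((tsupport_mul_subset_right (f := fun x : Space n => x i) (g := u)).trans hu)
  rw [this, map_zero]

theorem eulerContract_currentD_zero (T : Current 𝕜 n 0) (φ : 𝓓((⊤ : Opens (Space n)), ℝ)) :
    eulerContract (currentD 𝕜 n 0 T) φ = - T (euler n φ) - (n : ℝ) • T φ := by
  simp only [eulerContract_apply, currentD_apply, map_sum, contract_dxWedge_zero]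
  simp only [Finset.sum_ite_eq, Finset.mem_univ, if_true, Distribution.lineDerivOp_apply_apply,
    map_neg, lineDeriv_coordMul, if_true, map_add, neg_add, Finset.sum_add_distrib,
    Finset.sum_neg_distrib, euler_eq_sum, map_sum]
  simp only [Finset.sum_const, Finset.card_univ, Fintype.card_fin, ← Nat.cast_smul_eq_nsmul ℝ]
  abel

/-- Cartan's formula. The commutators of `∂ⱼ` with `xᵢ` contribute `∑ᵢ (1 - dxᵢ ∧ ιᵢ) = n - (k +
1)`; the remaining terms combine by `contract_dxWedge_add` into the Euler operator. -/
theorem currentD_eulerContract_add (T : Current 𝕜 n (k + 1))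
    (φ : 𝓓((⊤ : Opens (Space n)), ℝ)) :
    currentD 𝕜 n k (eulerContract T) φ + eulerContract (currentD 𝕜 n (k + 1) T) φ =
      - T (euler n φ) - ((n : ℝ) - (k + 1 : ℕ)) • T φ := by
  have h1 : currentD 𝕜 n k (eulerContract T) φ =
      - ∑ i : Fin n, ∑ j : Fin n, dxWedge j (contract i (T (coordMul i (∂_{unitVec j} φ)))) := by
    rw [currentD_apply, Finset.sum_comm, ← Finset.sum_neg_distrib]
    refine Finset.sum_congr rfl fun j _ => ?_
    rw [Distribution.lineDerivOp_apply_apply, map_neg, map_neg, eulerContract_apply, map_sum]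
  have h2 : eulerContract (currentD 𝕜 n (k + 1) T) φ =
      - ∑ i : Fin n, ∑ j : Fin n, (contract i (dxWedge j (T (if i = j then φ else 0))) +
        contract i (dxWedge j (T (coordMul i (∂_{unitVec j} φ))))) := by
    rw [eulerContract_apply, ← Finset.sum_neg_distrib]
    refine Finset.sum_congr rfl fun i _ => ?_
    rw [currentD_apply, map_sum, ← Finset.sum_neg_distrib]
    refine Finset.sum_congr rfl fun j _ => ?_
    rw [Distribution.lineDerivOp_apply_apply, lineDeriv_coordMul]
    simp only [map_neg, map_add]
  have h3 : ∑ i : Fin n, ∑ j : Fin n, contract i (dxWedge j (T (if i = j then φ else 0))) =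
      ((n : ℝ) - (k + 1 : ℕ)) • T φ := by
    have h4 : ∀ i : Fin n, ∑ j : Fin n, contract i (dxWedge j (T (if i = j then φ else 0))) =
        T φ - dxWedge i (contract i (T φ)) := by
      intro i
      rw [Finset.sum_eq_single i (fun j _ hj => by simp [Ne.symm hj]) (by simp), if_pos rfl,
        eq_sub_iff_add_eq, contract_dxWedge_add, if_pos rfl]
    simp only [h4, Finset.sum_sub_distrib, sum_dxWedge_contract]
    simp only [Finset.sum_const, Finset.card_univ, Fintype.card_fin, ← Nat.cast_smul_eq_nsmul ℝ]
    rw [← sub_smul]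
    push_cast
    rfl
  have h5 : ∑ i : Fin n, ∑ j : Fin n, (contract i (dxWedge j (T (coordMul i (∂_{unitVec j} φ)))) +
      dxWedge j (contract i (T (coordMul i (∂_{unitVec j} φ))))) = T (euler n φ) := by
    simp only [contract_dxWedge_add, Finset.sum_ite_eq, Finset.mem_univ, if_true, euler_eq_sum,
      map_sum]
  rw [h1, h2]
  simp only [Finset.sum_add_distrib] at h5 ⊢
  rw [h3, ← h5]
  abel

/-! ### Jets at the origin: Euler operator and Taylor bounds -/

section Flatness

-- The induction on `j` below replaces `F` by `E →L[ℝ] F`, so both spaces must share a universe.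
universe u

variable {E : Type u} [NormedAddCommGroup E] [NormedSpace ℝ E]

theorem fderiv_fderiv_apply_self {F : Type*} [NormedAddCommGroup F] [NormedSpace ℝ F] {f : E → F}
    (hf : ContDiff ℝ ∞ f) :
    fderiv ℝ (fun x => fderiv ℝ f x x) =
      (fun x => fderiv ℝ (fderiv ℝ f) x x) + fderiv ℝ f := by
  ext x v
  have hd : DifferentiableAt ℝ (fderiv ℝ f) x :=
    ((hf.fderiv_right (m := 1) (by norm_cast)).differentiable one_ne_zero).differentiableAt
  rw [fderiv_clm_apply hd differentiableAt_fun_id]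
  have hs : IsSymmSndFDerivAt ℝ f x :=
    (hf.contDiffAt (x := x)).isSymmSndFDerivAt (by simp; norm_cast)
  simp [hs v x, add_comm]

/-- At the origin, the `j`-th derivative of `x ↦ Df(x) x` is `j` times that of `f`. -/
theorem iteratedFDeriv_fderiv_apply_self_zero (j : ℕ) :
    ∀ {F : Type u} [NormedAddCommGroup F] [NormedSpace ℝ F] {f : E → F}, ContDiff ℝ ∞ f →
      iteratedFDeriv ℝ j (fun x => fderiv ℝ f x x) 0 = (j : ℝ) • iteratedFDeriv ℝ j f 0 := by
  induction j with
  | zero =>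
    intro F _ _ f hf
    ext v
    simp
  | succ j ih =>
    intro F _ _ f hf
    have hf' : ContDiff ℝ ∞ (fderiv ℝ f) := hf.fderiv_right (by norm_cast)
    have hg : ContDiff ℝ ∞ (fun x => fderiv ℝ (fderiv ℝ f) x x) :=
      (hf'.fderiv_right (m := ∞) (by norm_cast)).clm_apply contDiff_id
    have hj : (j : ℕ∞ω) ≤ ∞ := by exact_mod_cast le_top
    simp only [iteratedFDeriv_succ_eq_comp_right, Function.comp_apply]
    have h1 : iteratedFDeriv ℝ j (fun y => fderiv ℝ (fun x => fderiv ℝ f x x) y) 0 =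
        ((j + 1 : ℕ) : ℝ) • iteratedFDeriv ℝ j (fderiv ℝ f) 0 := by
      rw [show (fun y => fderiv ℝ (fun x => fderiv ℝ f x x) y) = _ from
        fderiv_fderiv_apply_self hf, iteratedFDeriv_add_apply (hg.of_le hj).contDiffAt
        (hf'.of_le hj).contDiffAt, ih hf']
      push_cast
      rw [add_smul, one_smul]
    rw [h1, map_smul]

/-- Taylor's estimate without the factorial: the mean value inequality on the ball of radius `‖x‖`
gains one power of `‖x‖` for each order descended from `N + 1`. -/
theorem norm_iteratedFDeriv_le_of_flat {F : Type*} [NormedAddCommGroup F] [NormedSpace ℝ F]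
    {f : E → F} (hf : ContDiff ℝ ∞ f) {N : ℕ} (h0 : ∀ j ≤ N, iteratedFDeriv ℝ j f 0 = 0) {C : ℝ}
    (hC : ∀ x, ‖iteratedFDeriv ℝ (N + 1) f x‖ ≤ C) (i : ℕ) :
    ∀ j, j + i = N + 1 → ∀ x, ‖iteratedFDeriv ℝ j f x‖ ≤ C * ‖x‖ ^ i := by
  have hC0 : 0 ≤ C := (norm_nonneg _).trans (hC 0)
  induction i with
  | zero =>
    intro j hj x
    obtain rfl : j = N + 1 := by omega
    simpa using hC x
  | succ i ih =>
    intro j hj x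
    have hd : Differentiable ℝ (iteratedFDeriv ℝ j f) :=
      hf.differentiable_iteratedFDeriv (by exact_mod_cast WithTop.coe_lt_top j)
    have := (convex_closedBall (0 : E) ‖x‖).norm_image_sub_le_of_norm_fderiv_le
      (𝕜 := ℝ) (f := iteratedFDeriv ℝ j f) (C := C * ‖x‖ ^ i) (x := 0) (y := x)
      (fun y _ => hd y) (fun y hy => by
        rw [norm_fderiv_iteratedFDeriv]
        refine (ih (j + 1) (by omega) y).trans ?_
        have : ‖y‖ ≤ ‖x‖ := by simpa using hy
        gcongr) (by simp) (by simp)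
    rw [h0 j (by omega), sub_zero, sub_zero] at this
    rwa [pow_succ, ← mul_assoc]

end Flatness

/-! ### Finite order of distributions supported at the origin -/

section FiniteOrder

variable {E : Type*} [NormedAddCommGroup E] [NormedSpace ℝ E] [FiniteDimensional ℝ E]
  {F : Type*} [NormedAddCommGroup F] [NormedSpace ℝ F]

omit [FiniteDimensional ℝ E] in
/-- A distribution has finite order on the test functions supported in a given compact set. -/
theorem exists_norm_le_supSeminorm (T : 𝓓'((⊤ : Opens E), F)) (K : Compacts E) :
    ∃ (s : Finset ℕ) (C : ℝ), 0 ≤ C ∧ ∀ (φ : 𝓓((⊤ : Opens E), ℝ)), tsupport φ ⊆ K →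
      ∀ B : ℝ, 0 ≤ B → (∀ j ∈ s, ∀ x ∈ K, ‖iteratedFDeriv ℝ j φ x‖ ≤ B) → ‖T φ‖ ≤ C * B := by
  have hK : (K : Set E) ⊆ (⊤ : Opens E) := fun _ _ => trivial
  let A : 𝓓_{K}(E, ℝ) →L[ℝ] F :=
    ContinuousLinearMap.comp (M₂ := 𝓓((⊤ : Opens E), ℝ)) T (TestFunction.ofSupportedInCLM ℝ hK)
  obtain ⟨s, C, -, h⟩ := Seminorm.bound_of_continuous
    (ContDiffMapSupportedIn.withSeminorms ℝ E ℝ ⊤ K)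
    ((normSeminorm ℝ F).comp A.toLinearMap) (by
      change Continuous fun f => ‖A f‖
      fun_prop)
  refine ⟨s, C, C.2, fun φ hφ B hB hb => ?_⟩
  let f : 𝓓_{K}(E, ℝ) := .of_support_subset φ.contDiff (subset_closure.trans hφ)
  have h1 : ‖T φ‖ ≤ C * (s.sup (ContDiffMapSupportedIn.seminorm ℝ E ℝ ⊤ K)) f := h f
  refine h1.trans (mul_le_mul_of_nonneg_left ?_ C.2)
  exact Seminorm.finset_sup_apply_le hB fun j hj =>
    (ContDiffMapSupportedIn.seminorm_top_le_iff ℝ hB j f).2 (hb j hj)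

theorem eq_zero_of_eventuallyEq_zero {T : 𝓓'((⊤ : Opens E), F)} (hT : dsupport T ⊆ {0})
    {φ : 𝓓((⊤ : Opens E), ℝ)} (h : φ =ᶠ[nhds 0] (0 : E → ℝ)) : T φ = 0 := by
  refine dsupport_subset_zero_iff.1 hT φ ?_
  rw [Set.subset_compl_singleton_iff]
  exact notMem_tsupport_iff_eventuallyEq.2 h

theorem tsupport_comp_smul_bump (χ : ContDiffBump (0 : E)) (h1 : χ.rOut = 1) {ε : ℝ}
    (hε : 0 < ε) : tsupport (fun x => χ (ε⁻¹ • x)) ⊆ Metric.closedBall 0 ε := by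
  refine closure_minimal (fun x hx => ?_) Metric.isClosed_closedBall
  have hx' : ε⁻¹ • x ∈ Function.support χ := hx
  rw [χ.support_eq, h1, mem_ball_zero_iff, norm_smul, norm_inv, Real.norm_of_nonneg hε.le,
    inv_mul_lt_one₀ hε] at hx'
  simpa using hx'.le

/-- Cutting off a flat function at scale `ε` makes its derivatives small. -/
theorem exists_norm_iteratedFDeriv_cutoff_le (χ : ContDiffBump (0 : E)) (h1 : χ.rOut = 1)
    {φ : E → ℝ} (hφ : ContDiff ℝ ∞ φ) (hc : HasCompactSupport φ) {N : ℕ}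
    (h0 : ∀ j ≤ N, iteratedFDeriv ℝ j φ 0 = 0) {j : ℕ} (hj : j ≤ N) :
    ∃ C : ℝ, 0 ≤ C ∧ ∀ ε : ℝ, 0 < ε → ε ≤ 1 → ∀ x,
      ‖iteratedFDeriv ℝ j (fun y => χ (ε⁻¹ • y) * φ y) x‖ ≤ C * ε := by
  have hχ : ContDiff ℝ ∞ χ := χ.contDiff
  have hb : ∀ i : ℕ, ∃ M, ∀ x, ‖iteratedFDeriv ℝ i χ x‖ ≤ M := fun i =>
    (hχ.continuous_iteratedFDeriv (by exact_mod_cast le_top)).bounded_above_of_compact_support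
      (χ.hasCompactSupport.iteratedFDeriv i)
  choose M hM using hb
  have hM0 : ∀ i, 0 ≤ M i := fun i => (norm_nonneg _).trans (hM i 0)
  obtain ⟨D, hD⟩ : ∃ D, ∀ x, ‖iteratedFDeriv ℝ (N + 1) φ x‖ ≤ D :=
    (hφ.continuous_iteratedFDeriv (by exact_mod_cast le_top)).bounded_above_of_compact_support
      (hc.iteratedFDeriv _)
  have hD0 : 0 ≤ D := (norm_nonneg _).trans (hD 0)
  refine ⟨∑ i ∈ Finset.range (j + 1), (j.choose i : ℝ) * M i * D,
    Finset.sum_nonneg fun i _ => by have := hM0 i; positivity, fun ε hε hε1 x => ?_⟩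
  by_cases hx : x ∈ Metric.closedBall (0 : E) ε
  · have hx' : ‖x‖ ≤ ε := by simpa using hx
    have hsc : ContDiff ℝ ∞ (fun y => χ (ε⁻¹ • y)) := hχ.comp (contDiff_const_smul _)
    refine (norm_iteratedFDeriv_mul_le hsc hφ x (by exact_mod_cast le_top)).trans ?_
    rw [Finset.sum_mul]
    refine Finset.sum_le_sum fun i hi => ?_
    have hij : i ≤ j := Nat.lt_succ_iff.1 (Finset.mem_range.1 hi)
    have e1 : ‖iteratedFDeriv ℝ i (fun y => χ (ε⁻¹ • y)) x‖ ≤ (ε⁻¹) ^ i * M i := by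
      rw [iteratedFDeriv_comp_const_smul _ (hχ.of_le (by exact_mod_cast le_top)), norm_smul,
        norm_pow, Real.norm_of_nonneg (inv_nonneg.2 hε.le)]
      have := hM i (ε⁻¹ • x)
      gcongr
    have e2 : ‖iteratedFDeriv ℝ (j - i) φ x‖ ≤ D * ε ^ (N + 1 - (j - i)) :=
      (norm_iteratedFDeriv_le_of_flat hφ h0 hD (N + 1 - (j - i)) (j - i) (by omega) x).trans
        (by gcongr)
    -- Differentiating the cutoff `i` times costs `ε⁻ⁱ`, but flatness gains `i + (N - j) + 1`
    -- powers, so at least one survives.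
    have e3 : (ε⁻¹) ^ i * ε ^ (N + 1 - (j - i)) ≤ ε := by
      rw [show N + 1 - (j - i) = i + ((N - j) + 1) by omega, pow_add, ← mul_assoc, ← mul_pow,
        inv_mul_cancel₀ hε.ne', one_pow, one_mul, pow_succ]
      exact mul_le_of_le_one_left hε.le (pow_le_one₀ hε.le hε1)
    have := hM0 i
    calc _ ≤ (j.choose i : ℝ) * ((ε⁻¹) ^ i * M i) * (D * ε ^ (N + 1 - (j - i))) := by gcongr
      _ = (j.choose i : ℝ) * M i * D * ((ε⁻¹) ^ i * ε ^ (N + 1 - (j - i))) := by ring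
      _ ≤ _ := by gcongr
  · have : iteratedFDeriv ℝ j (fun y => χ (ε⁻¹ • y) * φ y) x = 0 := by
      by_contra hne
      have h2 := support_iteratedFDeriv_subset j (Function.mem_support.2 hne)
      exact hx (tsupport_comp_smul_bump χ h1 hε (tsupport_mul_subset_left h2))
    rw [this, norm_zero]
    exact mul_nonneg (Finset.sum_nonneg fun i _ => by have := hM0 i; positivity) hε.le

/-- A distribution supported at the origin kills the test functions which are flat to a
sufficiently high order there. -/
theorem exists_forall_flat_eq_zero {T : 𝓓'((⊤ : Opens E), F)} (hT : dsupport T ⊆ {0}) :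
    ∃ N : ℕ, ∀ φ : 𝓓((⊤ : Opens E), ℝ), (∀ j ≤ N, iteratedFDeriv ℝ j φ 0 = 0) → T φ = 0 := by
  let K : Compacts E := ⟨Metric.closedBall 0 1, isCompact_closedBall _ _⟩
  obtain ⟨s, C, hC, h⟩ := exists_norm_le_supSeminorm T K
  let χ : ContDiffBump (0 : E) := ⟨1 / 2, 1, by norm_num, by norm_num⟩
  -- Flatness up to the highest order occurring in the seminorm bound on the unit ball suffices.
  refine ⟨s.sup id, fun φ hφ => ?_⟩
  have hb : ∀ j : s, ∃ B : ℝ, 0 ≤ B ∧ ∀ ε : ℝ, 0 < ε → ε ≤ 1 → ∀ x,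
      ‖iteratedFDeriv ℝ (j : ℕ) (fun y => χ (ε⁻¹ • y) * φ y) x‖ ≤ B * ε := fun j =>
    exists_norm_iteratedFDeriv_cutoff_le χ rfl φ.contDiff φ.hasCompactSupport hφ
      (Finset.le_sup (f := id) j.2)
  choose B hB0 hB using hb
  have hle : ∀ ε : ℝ, 0 < ε → ε ≤ 1 → ‖T φ‖ ≤ C * ((∑ j : s, B j) * ε) := by
    intro ε hε hε1
    have hsc : ContDiff ℝ ∞ (fun y => χ (ε⁻¹ • y)) := χ.contDiff.comp (contDiff_const_smul _)
    -- The cutoff is `1` near the origin, so it does not change the value of `T`, while the bound on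
    -- the right is `O(ε)`.
    have hφe : T φ = T (mulTest _ hsc φ) := by
      rw [← sub_eq_zero, ← map_sub]
      refine eq_zero_of_eventuallyEq_zero hT ?_
      have h1 : Filter.Tendsto (fun y : E => ε⁻¹ • y) (nhds 0) (nhds 0) := by
        simpa using (continuous_const_smul (ε⁻¹)).tendsto (0 : E)
      filter_upwards [h1.eventually χ.eventuallyEq_one] with y hy
      change φ y - χ (ε⁻¹ • y) * φ y = 0
      rw [hy]
      simp
    rw [hφe]
    have hS0 : 0 ≤ ∑ j : s, B j := Finset.sum_nonneg fun j _ => hB0 j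
    refine h _ ?_ _ (mul_nonneg hS0 hε.le) ?_
    · refine (tsupport_mul_subset_left (f := fun y => χ (ε⁻¹ • y)) (g := φ)).trans
        ((tsupport_comp_smul_bump χ rfl hε).trans ?_)
      exact Metric.closedBall_subset_closedBall hε1
    · intro j hj x _
      refine (hB ⟨j, hj⟩ ε hε hε1 x).trans (mul_le_mul_of_nonneg_right ?_ hε.le)
      exact Finset.single_le_sum (f := B) (fun j _ => hB0 j) (Finset.mem_univ _)
  have hlim : Filter.Tendsto (fun ε : ℝ => C * ((∑ j : s, B j) * ε)) (nhdsWithin 0 (Set.Ioi 0))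
      (nhds 0) := by
    have : Continuous (fun ε : ℝ => C * ((∑ j : s, B j) * ε)) := by fun_prop
    simpa using (this.tendsto 0).mono_left nhdsWithin_le_nhds
  refine norm_le_zero_iff.1 (ge_of_tendsto hlim ?_)
  filter_upwards [Ioc_mem_nhdsGT (zero_lt_one' ℝ)] with ε hε
  exact hle ε hε.1 hε.2

end FiniteOrder

/-! ### Shifted Euler operators -/

/-- The operator `m - ∑ᵢ xᵢ ∂ᵢ` on test functions. -/
def eulerShift (n m : ℕ) : 𝓓((⊤ : Opens (Space n)), ℝ) →L[ℝ] 𝓓((⊤ : Opens (Space n)), ℝ) :=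
  (m : ℝ) • ContinuousLinearMap.id ℝ _ - euler n

theorem eulerShift_apply (m : ℕ) (φ : 𝓓((⊤ : Opens (Space n)), ℝ)) :
    eulerShift n m φ = (m : ℝ) • φ - euler n φ := rfl

theorem iteratedFDeriv_eulerShift_zero (m j : ℕ) (φ : 𝓓((⊤ : Opens (Space n)), ℝ)) :
    iteratedFDeriv ℝ j (eulerShift n m φ) 0 = ((m : ℝ) - j) • iteratedFDeriv ℝ j φ 0 := by
  have h1 : (eulerShift n m φ : Space n → ℝ) =
      (m : ℝ) • (φ : Space n → ℝ) - fun x => fderiv ℝ φ x x := by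
    ext x
    change (m : ℝ) • φ x - euler n φ x = _
    rw [euler_apply]
    rfl
  have hj : (j : ℕ∞ω) ≤ ∞ := by exact_mod_cast le_top
  have hφ : ContDiff ℝ j φ := φ.contDiff.of_le hj
  have hg : ContDiff ℝ j (fun x => fderiv ℝ φ x x) :=
    (((φ.contDiff.fderiv_right (m := ∞) (by norm_cast))).clm_apply contDiff_id).of_le hj
  rw [h1]
  refine (iteratedFDeriv_sub_apply (hφ.const_smul (m : ℝ)).contDiffAt hg.contDiffAt).trans ?_
  rw [iteratedFDeriv_fderiv_apply_self_zero j φ.contDiff,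
    iteratedFDeriv_const_smul_apply' hφ.contDiffAt, sub_smul]

/-- The composition of the operators `m - ∑ᵢ xᵢ ∂ᵢ` over the entries `m` of a list. -/
def eulerShifts (n : ℕ) :
    List ℕ → (𝓓((⊤ : Opens (Space n)), ℝ) →L[ℝ] 𝓓((⊤ : Opens (Space n)), ℝ))
  | [] => ContinuousLinearMap.id ℝ _
  | m :: l => (eulerShift n m).comp (eulerShifts n l)

theorem iteratedFDeriv_eulerShifts_zero (j : ℕ) (φ : 𝓓((⊤ : Opens (Space n)), ℝ)) (l : List ℕ) :
    iteratedFDeriv ℝ j (eulerShifts n l φ) 0 =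
      (l.map fun m : ℕ => (m : ℝ) - j).prod • iteratedFDeriv ℝ j φ 0 := by
  induction l with
  | nil => simp [eulerShifts]
  | cons m l ih =>
    rw [eulerShifts, ContinuousLinearMap.comp_apply, iteratedFDeriv_eulerShift_zero, ih, smul_smul,
      List.map_cons, List.prod_cons]

theorem iteratedFDeriv_eulerShifts_zero_of_mem {j : ℕ} (φ : 𝓓((⊤ : Opens (Space n)), ℝ))
    {l : List ℕ} (hj : j ∈ l) : iteratedFDeriv ℝ j (eulerShifts n l φ) 0 = 0 := by
  rw [iteratedFDeriv_eulerShifts_zero, List.prod_eq_zero, zero_smul]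
  exact List.mem_map.2 ⟨j, hj, sub_self _⟩

/-! ### Boundaries -/

/-- The `k`-currents supported at the origin which are exterior derivatives of such currents. -/
def boundaries (𝕜 : Type*) [RCLike 𝕜] (n : ℕ) : (k : ℕ) → Submodule 𝕜 (Current 𝕜 n k)
  -- No differential enters degree `0`.
  | 0 => ⊥
  | k + 1 => (originCurrents 𝕜 n k).map (currentD 𝕜 n k)

theorem boundaries_le_ker : boundaries 𝕜 n k ≤ LinearMap.ker (currentD 𝕜 n k) := by
  cases k with
  | zero => exact bot_le
  | succ k =>
    rintro _ ⟨S, -, rfl⟩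
    exact currentD_currentD S

theorem boundaries_le_originCurrents : boundaries 𝕜 n k ≤ originCurrents 𝕜 n k := by
  cases k with
  | zero => exact bot_le
  | succ k =>
    rintro _ ⟨S, hS, rfl⟩
    exact currentD_mem hS

/-- The Lie derivative of a current along the Euler vector field. -/
def eulerLie (T : Current 𝕜 n k) : Current 𝕜 n k :=
  -- `eulerShift n 0` is `-euler n`.
  transpose (eulerShift n 0) T - ((n : 𝕜) - k) • T

/-- Test functions are real, so transposition produces real scalars, whereas the submodules are over
`𝕜`. -/
theorem natCast_sub_smul (a b : ℕ) (η : ConstForm 𝕜 n k) :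
    ((a : ℝ) - b) • η = ((a : 𝕜) - b) • η := by
  ext v
  change ((a : ℝ) - b) • η v = ((a : 𝕜) - b) • η v
  rw [RCLike.real_smul_eq_coe_mul]
  simp

theorem eulerLie_apply (T : Current 𝕜 n k) (φ : 𝓓((⊤ : Opens (Space n)), ℝ)) :
    eulerLie T φ = - T (euler n φ) - ((n : ℝ) - k) • T φ := by
  change T (eulerShift n 0 φ) - ((n : 𝕜) - k) • T φ = _
  rw [eulerShift_apply, natCast_sub_smul]
  simp

theorem transpose_eulerShift (m : ℕ) (T : Current 𝕜 n k) :
    transpose (eulerShift n m) T = eulerLie T + ((n : 𝕜) - k + m) • T := by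
  ext1 φ
  change T (eulerShift n m φ) = eulerLie T φ + ((n : 𝕜) - k + m) • T φ
  have h : (m : ℝ) • T φ = (m : 𝕜) • T φ := by simpa using natCast_sub_smul m 0 (T φ)
  rw [eulerLie_apply, eulerShift_apply, map_sub, map_smul, natCast_sub_smul, h]
  module

theorem eulerLie_mem_boundaries {T : Current 𝕜 n k} (hT : T ∈ originCurrents 𝕜 n k)
    (hd : currentD 𝕜 n k T = 0) : eulerLie T ∈ boundaries 𝕜 n k := by
  cases k with
  | zero =>
    refine (Submodule.mem_bot 𝕜).2 ?_
    ext1 φ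
    have h := eulerContract_currentD_zero T φ
    rw [hd, eulerContract_apply] at h
    rw [eulerLie_apply, Nat.cast_zero, sub_zero, ← h]
    exact Finset.sum_eq_zero fun i _ => map_zero _
  | succ k =>
    refine ⟨eulerContract T, eulerContract_mem hT, ?_⟩
    ext1 φ
    have h := currentD_eulerContract_add T φ
    have h0 : eulerContract (currentD 𝕜 n (k + 1) T) φ = 0 := by
      rw [hd, eulerContract_apply]
      exact Finset.sum_eq_zero fun i _ => map_zero _
    rw [h0, add_zero] at h
    rw [h, eulerLie_apply]

/-- A closed current annihilated by a product of operators `L + n - k + m`, where `L` is the Lie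
derivative along the Euler vector field and `n - k + m ≠ 0`, is exact. -/
theorem mem_boundaries_of_eulerShifts (l : List ℕ) (hl : ∀ m ∈ l, (n : 𝕜) - k + m ≠ 0) :
    ∀ {T : Current 𝕜 n k}, T ∈ originCurrents 𝕜 n k → currentD 𝕜 n k T = 0 →
      (∀ φ, T (eulerShifts n l φ) = 0) → T ∈ boundaries 𝕜 n k := by
  induction l with
  | nil =>
    intro T _ _ h
    have : T = 0 := by
      ext1 φ
      exact h φ
    rw [this]
    exact zero_mem _
  | cons m l ih =>
    intro T hT hd h
    have hL := eulerLie_mem_boundaries hT hd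
    have hS := transpose_eulerShift m T
    -- The head of the list is the outermost operator, so it is the one that moves onto `T`.
    have h1 : transpose (eulerShift n m) T ∈ boundaries 𝕜 n k := by
      refine ih (fun m hm => hl m (List.mem_cons_of_mem _ hm)) ?_ ?_ h
      · rw [hS]
        exact add_mem (boundaries_le_originCurrents hL) (Submodule.smul_mem _ _ hT)
      · have h2 : currentD 𝕜 n k (eulerLie T) = 0 := boundaries_le_ker hL
        rw [hS]
        exact add_mem (S := Submodule 𝕜 (Current 𝕜 n k)) (s := LinearMap.ker (currentD 𝕜 n k)) h2
          (Submodule.smul_mem _ _ hd)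
    -- The Lie derivative term is already exact, so the scalar multiple of `T` is exact, and the
    -- scalar is invertible.
    rw [hS, add_comm] at h1
    exact (Submodule.smul_mem_iff _ (hl m List.mem_cons_self)).1
      ((Submodule.add_mem_iff_left _ hL).1 h1)

theorem mem_boundaries_of_lt (hk : k < n) {T : Current 𝕜 n k} (hT : T ∈ originCurrents 𝕜 n k)
    (hd : currentD 𝕜 n k T = 0) : T ∈ boundaries 𝕜 n k := by
  obtain ⟨N, hN⟩ := exists_forall_flat_eq_zero hT
  refine mem_boundaries_of_eulerShifts (List.range (N + 1)) (fun m _ => ?_) hT hd fun φ => ?_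
  · obtain ⟨p, rfl⟩ := Nat.exists_eq_add_of_lt hk
    have : ((p + 1 + m : ℕ) : 𝕜) ≠ 0 := Nat.cast_ne_zero.2 (by omega)
    push_cast at this ⊢
    convert this using 1
    ring
  · exact hN _ fun j hj =>
      iteratedFDeriv_eulerShifts_zero_of_mem φ (List.mem_range.2 (Nat.lt_succ_of_le hj))

/-! ### The top degree -/

/-- A test function equal to `1` near the origin. -/
def bump (n : ℕ) : 𝓓((⊤ : Opens (Space n)), ℝ) :=
  let χ : ContDiffBump (0 : Space n) := ⟨1 / 2, 1, by norm_num, by norm_num⟩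
  ⟨χ, χ.contDiff, χ.hasCompactSupport, fun _ _ => trivial⟩

theorem bump_eventuallyEq : bump n =ᶠ[nhds 0] fun _ => (1 : ℝ) :=
  ContDiffBump.eventuallyEq_one _

theorem bump_zero : bump n 0 = 1 := bump_eventuallyEq.eq_of_nhds

theorem iteratedFDeriv_bump_zero {j : ℕ} (hj : j ≠ 0) : iteratedFDeriv ℝ j (bump n) 0 = 0 := by
  rw [(bump_eventuallyEq.iteratedFDeriv ℝ j).eq_of_nhds, iteratedFDeriv_const_of_ne hj]
  rfl

/-- The derivatives of `bump n` vanish near the origin, where the primitive is supported. Evaluation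
on `bump n` thus detects the class of `deltaVol`. -/
theorem apply_bump_eq_zero {T : Current 𝕜 n k} (hT : T ∈ boundaries 𝕜 n k) : T (bump n) = 0 := by
  cases k with
  | zero =>
    rw [(Submodule.mem_bot 𝕜).1 hT]
    rfl
  | succ k =>
    obtain ⟨S, hS, rfl⟩ := hT
    rw [currentD_apply]
    refine Finset.sum_eq_zero fun i _ => ?_
    rw [Distribution.lineDerivOp_apply_apply, map_neg, eq_zero_of_eventuallyEq_zero hS, neg_zero,
      map_zero]
    filter_upwards [bump_eventuallyEq.fderiv (𝕜 := ℝ)] with x hx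
    rw [lineDeriv_test_apply, hx]
    simp

theorem eq_zero_of_lt (hk : n < k) (T : Current 𝕜 n k) : T = 0 := by
  ext1 φ
  ext v
  exact (T φ).toAlternatingMap.map_linearDependent v fun h => by
    have := h.fintype_card_le_finrank
    simp at this
    omega

theorem mem_boundaries_of_apply_bump {T : Current 𝕜 n n} (hT : T ∈ originCurrents 𝕜 n n)
    (h : T (bump n) = 0) : T ∈ boundaries 𝕜 n n := by
  obtain ⟨N, hN⟩ := exists_forall_flat_eq_zero hT
  -- The shifts are `1, …, N`: for `k = n` the shift `0` would give the scalar `0`.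
  refine mem_boundaries_of_eulerShifts ((List.range N).map (· + 1)) (fun m hm => ?_) hT
    (eq_zero_of_lt n.lt_succ_self _) fun φ => ?_
  · obtain ⟨p, -, rfl⟩ := List.mem_map.1 hm
    rw [sub_self, zero_add]
    exact Nat.cast_ne_zero.2 p.succ_ne_zero
  · set ψ := eulerShifts n ((List.range N).map (· + 1)) φ with hψ
    -- Flat to order `N`: the shifts kill orders `1` to `N` of `ψ`, and subtracting `ψ 0 • bump n`
    -- kills order `0` without disturbing the others.
    have h1 : T (ψ - ψ 0 • bump n) = 0 := by
      refine hN _ fun j hj => ?_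
      have hj' : (j : ℕ∞ω) ≤ ∞ := by exact_mod_cast le_top
      have e : iteratedFDeriv ℝ j (ψ - ψ 0 • bump n : 𝓓((⊤ : Opens (Space n)), ℝ)) 0 =
          iteratedFDeriv ℝ j ψ 0 - ψ 0 • iteratedFDeriv ℝ j (bump n) 0 := by
        have hb : ContDiff ℝ j (bump n) := (bump n).contDiff.of_le hj'
        rw [← iteratedFDeriv_const_smul_apply hb.contDiffAt]
        exact iteratedFDeriv_sub_apply (ψ.contDiff.of_le hj').contDiffAt
          (hb.const_smul (ψ 0)).contDiffAt
      rw [e]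
      rcases Nat.eq_zero_or_pos j with rfl | hj0
      · ext v
        simp [bump_zero]
      · rw [iteratedFDeriv_bump_zero hj0.ne', smul_zero, sub_zero, hψ]
        exact iteratedFDeriv_eulerShifts_zero_of_mem φ
          (List.mem_map.2 ⟨j - 1, List.mem_range.2 (by omega), by omega⟩)
    rw [map_sub, map_smul, h] at h1
    refine (sub_eq_zero.1 h1).trans ?_
    ext v
    exact smul_zero (ψ 0)

theorem volForm_basis : volForm 𝕜 n (EuclideanSpace.basisFun (Fin n) ℝ) = 1 := by
  rw [volForm_apply]
  have : (Matrix.of fun i j => (EuclideanSpace.basisFun (Fin n) ℝ i) j) = 1 := by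
    ext i j
    simp [Matrix.one_apply, eq_comm]
  rw [this, Matrix.det_one, map_one]

theorem exists_eq_smul_volForm (η : ConstForm 𝕜 n n) : ∃ c : 𝕜, η = c • volForm 𝕜 n := by
  let e := (EuclideanSpace.basisFun (Fin n) ℝ).toBasis
  refine ⟨η e, ?_⟩
  have h : (η - η e • volForm 𝕜 n).toAlternatingMap = 0 := by
    refine Module.Basis.ext_alternating e fun σ hσ => ?_
    obtain ⟨τ, rfl⟩ : ∃ τ : Equiv.Perm (Fin n), τ = σ :=
      ⟨Equiv.ofBijective σ (Finite.injective_iff_bijective.1 hσ), rfl⟩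
    refine (AlternatingMap.map_perm _ e τ).trans ?_
    suffices h0 : (η - η e • volForm 𝕜 n).toAlternatingMap e = 0 by
      rw [h0, smul_zero]
      rfl
    change η e - η e • volForm 𝕜 n e = 0
    have : volForm 𝕜 n e = 1 := by
      simpa [e] using volForm_basis (𝕜 := 𝕜) (n := n)
    rw [this, smul_eq_mul, mul_one, sub_self]
  rw [← sub_eq_zero]
  ext v
  exact congrArg (fun f : AlternatingMap ℝ (Space n) 𝕜 (Fin n) => f v) h

theorem deltaVol_apply (φ : 𝓓((⊤ : Opens (Space n)), ℝ)) :
    deltaVol 𝕜 n φ = φ 0 • volForm 𝕜 n := rfl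

theorem deltaVol_notMem_boundaries : deltaVol 𝕜 n ∉ boundaries 𝕜 n n := fun h => by
  have h1 := apply_bump_eq_zero h
  rw [deltaVol_apply, bump_zero, one_smul] at h1
  have h2 := volForm_basis (𝕜 := 𝕜) (n := n)
  rw [h1] at h2
  exact zero_ne_one h2

theorem exists_sub_smul_deltaVol_mem_boundaries {T : Current 𝕜 n n}
    (hT : T ∈ originCurrents 𝕜 n n) : ∃ c : 𝕜, T - c • deltaVol 𝕜 n ∈ boundaries 𝕜 n n := by
  obtain ⟨c, hc⟩ := exists_eq_smul_volForm (T (bump n))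
  refine ⟨c, mem_boundaries_of_apply_bump
    (sub_mem hT (Submodule.smul_mem _ _ (deltaVol_mem 𝕜 n))) ?_⟩
  change T (bump n) - c • deltaVol 𝕜 n (bump n) = 0
  rw [deltaVol_apply, bump_zero, one_smul, hc, sub_self]

universe v

/-! ### Homology of complexes of modules -/

section Homology

variable {R : Type*} [Ring R] (K : CochainComplex (ModuleCat.{v} R) ℕ)

theorem iCycles_injective (i : ℕ) : Function.Injective (K.iCycles i).hom :=
  (ModuleCat.mono_iff_injective _).1 inferInstance

theorem homologyπ_surjective (i : ℕ) : Function.Surjective (K.homologyπ i).hom :=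
  (ModuleCat.epi_iff_surjective _).1 inferInstance

theorem d_iCycles_apply (i j : ℕ) (z : K.cycles i) :
    (K.d i j).hom ((K.iCycles i).hom z) = 0 := by
  rw [← ModuleCat.comp_apply, K.iCycles_d]
  rfl

theorem exists_iCycles_eq {i : ℕ} {x : K.X i} (hx : (K.d i (i + 1)).hom x = 0) :
    ∃ z : K.cycles i, (K.iCycles i).hom z = x := by
  let f : ModuleCat.of R (LinearMap.ker (K.d i (i + 1)).hom) ⟶ K.X i :=
    ModuleCat.ofHom (LinearMap.ker (K.d i (i + 1)).hom).subtype
  have hf : f ≫ K.d i (i + 1) = 0 := by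
    ext y
    exact y.2
  refine ⟨(K.liftCycles f (i + 1) (CochainComplex.next ℕ i) hf).hom ⟨x, hx⟩, ?_⟩
  rw [← ModuleCat.comp_apply, K.liftCycles_i]
  rfl

/-- Homology is the cokernel of `toCycles`. Using `prev i` treats degree `0` uniformly. -/
theorem homologyπ_eq_zero_iff (i : ℕ) (z : K.cycles i) :
    (K.homologyπ i).hom z = 0 ↔
      ∃ y, (K.d ((ComplexShape.up ℕ).prev i) i).hom y = (K.iCycles i).hom z := by
  have hex := ShortComplex.exact_of_g_is_cokernel
    (ShortComplex.mk _ _ (K.toCycles_comp_homologyπ ((ComplexShape.up ℕ).prev i) i))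
    (K.homologyIsCokernel _ i rfl)
  rw [ShortComplex.moduleCat_exact_iff] at hex
  constructor
  · intro h
    obtain ⟨y, hy⟩ := hex z h
    refine ⟨y, ?_⟩
    rw [← K.toCycles_i ((ComplexShape.up ℕ).prev i) i, ModuleCat.comp_apply]
    exact congrArg _ hy
  · rintro ⟨y, hy⟩
    rw [← K.toCycles_i ((ComplexShape.up ℕ).prev i) i, ModuleCat.comp_apply] at hy
    rw [← iCycles_injective K i hy, ← ModuleCat.comp_apply, K.toCycles_comp_homologyπ]
    rfl

end Homology

/-! ### Homology of the complex in terms of closed and exact currents -/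

/-- The current underlying an element of the complex. -/
def toCurrent (x : (originComplex 𝕜 n).X k) : Current 𝕜 n k :=
  Submodule.subtype (originCurrents 𝕜 n k) x

theorem toCurrent_mem (x : (originComplex 𝕜 n).X k) : toCurrent x ∈ originCurrents 𝕜 n k :=
  Subtype.property (p := (· ∈ originCurrents 𝕜 n k)) x

theorem toCurrent_d (x : (originComplex 𝕜 n).X k) :
    toCurrent (((originComplex 𝕜 n).d k (k + 1)).hom x) = currentD 𝕜 n k (toCurrent x) := by
  have h : (originComplex 𝕜 n).d k (k + 1) = ModuleCat.ofHom (originD 𝕜 n k) :=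
    CochainComplex.of_d (V := ModuleCat 𝕜) (fun k => ModuleCat.of 𝕜 (originCurrents 𝕜 n k))
      (fun k => ModuleCat.ofHom (originD 𝕜 n k)) k
  rw [h]
  rfl

theorem exists_d_prev_eq_iff (x : (originComplex 𝕜 n).X k) :
    (∃ y, ((originComplex 𝕜 n).d ((ComplexShape.up ℕ).prev k) k).hom y = x) ↔
      toCurrent x ∈ boundaries 𝕜 n k := by
  cases k with
  | zero =>
    -- By convention `prev 0` is `0`, and `0` is not related to itself, so this differential is
    -- zero.
    have h : (originComplex 𝕜 n).d ((ComplexShape.up ℕ).prev 0) 0 = 0 :=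
      (originComplex 𝕜 n).shape _ _ (by simp)
    rw [h]
    constructor
    · rintro ⟨y, rfl⟩
      exact zero_mem _
    · intro hx
      exact ⟨0, (Subtype.ext ((Submodule.mem_bot 𝕜).1 hx)).symm⟩
  | succ k =>
    rw [(ComplexShape.up ℕ).prev_eq' (show (ComplexShape.up ℕ).Rel k (k + 1) from rfl)]
    constructor
    · rintro ⟨y, rfl⟩
      exact ⟨toCurrent y, toCurrent_mem y, (toCurrent_d y).symm⟩
    · rintro ⟨S, hS, h⟩
      refine ⟨(⟨S, hS⟩ : originCurrents 𝕜 n k), Subtype.ext ?_⟩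
      exact (toCurrent_d _).trans h

theorem homologyπ_eq_zero_iff_mem_boundaries (z : (originComplex 𝕜 n).cycles k) :
    ((originComplex 𝕜 n).homologyπ k).hom z = 0 ↔
      toCurrent (((originComplex 𝕜 n).iCycles k).hom z) ∈ boundaries 𝕜 n k := by
  rw [homologyπ_eq_zero_iff, exists_d_prev_eq_iff]

theorem currentD_toCurrent_iCycles (z : (originComplex 𝕜 n).cycles k) :
    currentD 𝕜 n k (toCurrent (((originComplex 𝕜 n).iCycles k).hom z)) = 0 := by
  rw [← toCurrent_d, d_iCycles_apply]
  rfl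

theorem isZero_homology (hk : k ≠ n) : Limits.IsZero ((originComplex 𝕜 n).homology k) := by
  rw [ModuleCat.isZero_iff_subsingleton]
  refine subsingleton_of_forall_eq 0 fun c => ?_
  obtain ⟨z, rfl⟩ := homologyπ_surjective _ k c
  rw [homologyπ_eq_zero_iff_mem_boundaries]
  rcases hk.lt_or_gt with h | h
  · exact mem_boundaries_of_lt h (toCurrent_mem _) (currentD_toCurrent_iCycles z)
  · rw [eq_zero_of_lt h (toCurrent _)]
    exact zero_mem _

theorem exists_iCycles_eq_deltaCochain :
    ∃ z : (originComplex 𝕜 n).cycles n,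
      ((originComplex 𝕜 n).iCycles n).hom z = deltaCochain 𝕜 n :=
  -- Closedness is automatic: the derivative is an `(n + 1)`-current.
  exists_iCycles_eq _ (Subtype.ext (eq_zero_of_lt n.lt_succ_self _))

end OriginCurrents
end

theorem lemma10p11p1999p6 (𝕜 : Type*) [RCLike 𝕜] (n : ℕ) :
    (∀ k : ℕ, k ≠ n → Limits.IsZero ((OriginCurrents.originComplex 𝕜 n).homology k)) ∧
    Module.finrank 𝕜 ((OriginCurrents.originComplex 𝕜 n).homology n) = 1 ∧
    ∃ z : (OriginCurrents.originComplex 𝕜 n).cycles n,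
      ((OriginCurrents.originComplex 𝕜 n).iCycles n).hom z = OriginCurrents.deltaCochain 𝕜 n ∧
      Submodule.span 𝕜 {((OriginCurrents.originComplex 𝕜 n).homologyπ n).hom z} = ⊤ := by
  obtain ⟨z, hz⟩ := OriginCurrents.exists_iCycles_eq_deltaCochain (𝕜 := 𝕜) (n := n)
  have hspan : ∀ c, ∃ a : 𝕜, a • ((OriginCurrents.originComplex 𝕜 n).homologyπ n).hom z = c := by
    intro c
    obtain ⟨w, rfl⟩ := OriginCurrents.homologyπ_surjective _ n c
    obtain ⟨a, ha⟩ := OriginCurrents.exists_sub_smul_deltaVol_mem_boundaries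
      (OriginCurrents.toCurrent_mem (((OriginCurrents.originComplex 𝕜 n).iCycles n).hom w))
    refine ⟨a, ?_⟩
    rw [← map_smul, eq_comm, ← sub_eq_zero, ← map_sub,
      OriginCurrents.homologyπ_eq_zero_iff_mem_boundaries, map_sub, map_smul, hz]
    exact ha
  have hne : ((OriginCurrents.originComplex 𝕜 n).homologyπ n).hom z ≠ 0 := by
    rw [Ne, OriginCurrents.homologyπ_eq_zero_iff_mem_boundaries, hz]
    exact OriginCurrents.deltaVol_notMem_boundaries
  refine ⟨fun k hk => OriginCurrents.isZero_homology hk, finrank_eq_one _ hne hspan, z, hz, ?_⟩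
  refine (Submodule.eq_top_iff').2 fun c => Submodule.mem_span_singleton.2 (hspan c)
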